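/- A feedforward ReLU network $f:\mathbb{R}^d\to\mathbb{R}$ is a composition $T^{(L)}\circ[\cdot]_+\circ T^{(L-1)}\circ\dots\circ[\cdot]_+\circ T^{(1)}$, $L\ge 1$, of affine maps $T^{(l)}:\mathbb{R}^{d_{l-1}}\to\mathbb{R}^{d_l}$ with $d_0=d$, $d_L=1$ and the entrywise ReLU $[t]_+=\max\{0,t\}$; its width is $\max\{d_1,\dots,d_{L-1}\}$. A dataset of size $N$ with $C$ classes is a set $\mathcal D=\{(x_i,y_i)\}_{i=1}^N\subset\mathbb{R}^d\times\{1,\dots,C\}$ of $N$ elements; it is $\delta$-separated if $\min\{\|x_i-x_j\|_2 : y_i\ne y_j\}=\delta$. A function $f$ $(\sigma,p)$-robustly memorizes $\mathcal D$ if $f(x)=y_i$ for all $i$ and all $x$ with $\|x-x_i\|_p\le\sigma$. Corollary. There exist universal constants $C_1,C_2>0$ such that for all $p\in[2,\infty]$, all integers $N,d,C\ge 2$, all integers $0\le k<d$, and all $\delta,\sigma>0$: 1. (Sufficiency) If $k\ge 7$, $\delta/\sigma>d$ and $$k> C_1\frac{\log N}{\log(\delta/\sigma)-\log d},$$ then every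 $\delta$-separated dataset of size $N$ in $\mathbb{R}^d$ with $C$ classes is $(\sigma,p)$-robustly memorized by some ReLU network of width $k$. 2. (Necessity) If every $\delta$-separated dataset of size $N$ in $\mathbb{R}^d$ with $C$ classes is $(\sigma,p)$-robustly memorized by some ReLU network of width $k$, then $\delta/\sigma>1$ and $$k> C_2\frac{\log N}{\log(\delta/\sigma)}.$$ Consequently, width logarithmic in $N$ is necessary and sufficient when the robustness radius does not depend on $N$, in the following sense, where $p\in[2,\infty]$, $N,d,C\ge 2$, $0\le k<d$ and $\delta,\sigma>0$ are arbitrary. 3. (Sufficiency) For every $\eta>1$ there is $b>0$, depending only on $\eta$, such that if $\delta/\sigma\ge\eta d$, $k\ge 7$ and $k>b\log N$, then every $\delta$-separated dataset of size $N$ in $\mathbb{R}^d$ with $C$ classes is $(\sigma,p)$-robustly memorized by some ReLU network of width $k$. 4. (Necessity) For every $\rho>0$ there is $a>0$, depending only on $\rho$, such that if $\sigma/\delta\ge\rho$ and every $\delta$-separated dataset of size $N$ in $\mathbb{R}^d$ with $C$ classes is $(\sigma,p)$-robustly memorized by some ReLU network of width $k$, then $k>a\log N$. -/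

import Mathlib

open scoped ENNReal

namespace RobustMemo

/-- The `l_p` norm on `ℝ^d`: `(∑ |x_i|^p)^(1/p)` for `0 < p < ∞` and `max |x_i|` for `p = ∞`. -/
noncomputable def lpNorm {d : ℕ} (p : ℝ≥0∞) (x : Fin d → ℝ) : ℝ :=
  ‖WithLp.toLp p x‖

/-- Feedforward ReLU networks `ℝ^n → ℝ`.  A network is either a single affine output layer
`ℝ^n → ℝ`, or an affine layer `ℝ^n → ℝ^m` followed by the entrywise ReLU and then by a
network `ℝ^m → ℝ`.  No activation is applied after the output layer. -/
inductive ReLUNet : ℕ → Type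
  | output {n : ℕ} (W : Matrix (Fin 1) (Fin n) ℝ) (b : Fin 1 → ℝ) : ReLUNet n
  | hidden {n m : ℕ} (W : Matrix (Fin m) (Fin n) ℝ) (b : Fin m → ℝ) (next : ReLUNet m) :
      ReLUNet n

/-- The function computed by a network. -/
def ReLUNet.eval : {n : ℕ} → ReLUNet n → (Fin n → ℝ) → ℝ
  | _, .output W b, x => (W.mulVec x + b) 0
  | _, .hidden W b next, x => next.eval (fun i => max 0 ((W.mulVec x + b) i))

/-- The width of a network: the maximal dimension of a hidden layer
(`0` if there are no hidden layers). -/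
def ReLUNet.width : {n : ℕ} → ReLUNet n → ℕ
  | _, .output _ _ => 0
  | _, .hidden (m := m) _ _ next => max m next.width

/-- `D` is a dataset of size `N` in `ℝ^d` with labels in `{1, …, C}`. -/
def IsDataset {d : ℕ} (N C : ℕ) (D : Finset ((Fin d → ℝ) × ℕ)) : Prop :=
  D.card = N ∧ ∀ z ∈ D, 1 ≤ z.2 ∧ z.2 ≤ C

/-- `D` is `δ`-separated: the minimal Euclidean distance between data points
with different labels exists and is equal to `δ`. -/
def IsSeparated {d : ℕ} (δ : ℝ) (D : Finset ((Fin d → ℝ) × ℕ)) : Prop :=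
  IsLeast {r : ℝ | ∃ z ∈ D, ∃ w ∈ D, z.2 ≠ w.2 ∧ r = lpNorm 2 (z.1 - w.1)} δ

/-- `f` takes the value of the label on the closed `l_p` ball of radius `σ` around every
data point of `D`. -/
def RobustlyMemorizes {d : ℕ} (σ : ℝ) (p : ℝ≥0∞) (f : (Fin d → ℝ) → ℝ)
    (D : Finset ((Fin d → ℝ) × ℕ)) : Prop :=
  ∀ z ∈ D, ∀ x : Fin d → ℝ, lpNorm p (x - z.1) ≤ σ → f x = (z.2 : ℝ)

/-- Every `δ`-separated dataset of size `N` in `ℝ^d` with `C` classes is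
`(σ, p)`-robustly memorized by some network of width `k` (and of any depth). -/
def WidthSuffices (N d C k : ℕ) (δ σ : ℝ) (p : ℝ≥0∞) : Prop :=
  ∀ D : Finset ((Fin d → ℝ) × ℕ), IsDataset N C D → IsSeparated δ D →
    ∃ f : ReLUNet d, f.width = k ∧ RobustlyMemorizes σ p f.eval D

end RobustMemo

/-!
**Sufficiency.** An `l_p` ball with `p ≥ 1` lies in the cube of the same radius `σ`, so it is enough
to memorize cubes. Let `G` be an `m × d` Gaussian matrix. For `m ≤ d`, the norm of `G` from `l_∞` to
`l_1` is with high probability at most a multiple of `d √m` (a Chernoff bound for each of the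
`2 ^ (m + d)` pairs of sign vectors), while for a fixed `v` the small-ball estimate
`P(‖G v‖₁ ≤ T) ≤ (e T / (m ‖v‖)) ^ m` follows from the boundedness of the Gaussian density. With
`T` twice the image of a cube and `r = δ / (σ d)`, the base of this power is at most
`16 / (r √m)`, so a union bound over the at most `N ^ 2` pairs of data points gives a `G` whose
images of the cubes lie in `l_1` balls of one radius, with centres of different labels more than
twice this radius apart (`exists_gaussian_rows`, `sum_abs_inner_le`). The base is at most
`r ^ (-1/2)` as soon as `m r ≥ 256`. If `m` is small, then `k > C₁ log N / log r` forces `r` to be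
large, so this holds in either case once `C₁` is large, and `m log r ≥ 6 log N` then closes the
union bound (`widthSuffices_of_lt`).

In `ℝ^m`, a network of width `m + 3` carries the `m` coordinates of `G x`, computes the `l_1`
distances to the centres one coordinate at a time, and keeps the running maximum of the truncated
bumps `label - K * max 0 (distance - radius)` (`exists_net_of_l1_separated`). For `k ≥ 7` this
permits `m = k - 3`, which is at least `4 k / 7`.

**Necessity.** The first layer of a network of width `k < d` maps any `(k + 1)`-dimensional
subspace non-injectively. Put the origin with one label and a `2σ`-net of the `δ`-sphere of such a
subspace with another: a line in the kernel passes within `2σ` of a point of the net, so the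
network takes equal values somewhere in the balls around that point and around the origin
(`WidthSuffices.card_le`). Hence `N` is at most the bound `(1 + δ / σ) ^ (k + 1)` for the
cardinality of the net. Two points at distance `δ` already force `δ > 2σ`, which turns this into
`log N ≤ 4 k log (δ / σ)`; the width `0` is excluded separately, since then the network is affine
(`WidthSuffices.two_lt_and_pos`).
-/

namespace RobustMemo

/-! ### Layer-by-layer construction of networks -/

/-- A family `g` of functions on `ℝ^d` is *reachable* on `S` with width `k` if every network that
reads the values of `g` as its input and has width exactly `k` can be turned into a network of
width `k` on `ℝ^d`, correct on `S`.  The family is indexed by an arbitrary type, identified with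
`Fin n`, so that the registers of a computation can be given names. -/
def Reach {d : ℕ} (S : Set (Fin d → ℝ)) (k : ℕ) {ι : Type} [Fintype ι]
    (g : ι → (Fin d → ℝ) → ℝ) : Prop :=
  ∃ (n : ℕ) (e : ι ≃ Fin n), ∀ next : ReLUNet n, next.width = k →
    ∃ f : ReLUNet d, f.width = k ∧ ∀ x ∈ S, f.eval x = next.eval (fun i => g (e.symm i) x)

section

variable {d k : ℕ} {S : Set (Fin d → ℝ)} {ι κ : Type} [Fintype ι] [Fintype κ]

lemma reach_coordinates (S : Set (Fin d → ℝ)) (k : ℕ) : Reach S k (fun (i : Fin d) x => x i) :=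
  ⟨d, Equiv.refl _, fun next h => ⟨next, h, fun _ _ => rfl⟩⟩

/-- One more layer: every member of `h` is the ReLU of an affine combination of the members
of `g`. -/
lemma Reach.layer {g : ι → (Fin d → ℝ) → ℝ} (hg : Reach S k g) {h : κ → (Fin d → ℝ) → ℝ}
    (hk : Fintype.card κ ≤ k)
    (H : ∀ i, ∃ (w : ι → ℝ) (b : ℝ), ∀ x ∈ S, h i x = max 0 (∑ j, w j * g j x + b)) :
    Reach S k h := by
  obtain ⟨n, e, he⟩ := hg
  choose w b hw using H
  let e' := Fintype.equivFin κ
  refine ⟨Fintype.card κ, e', fun next hnext => ?_⟩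
  obtain ⟨f, hf, hfe⟩ := he
    (.hidden (Matrix.of fun i j => w (e'.symm i) (e.symm j)) (fun i => b (e'.symm i)) next)
    (by simp [ReLUNet.width, hnext, hk])
  refine ⟨f, hf, fun x hx => ?_⟩
  rw [hfe x hx, ReLUNet.eval]
  congr 1
  funext i
  rw [hw _ x hx, Pi.add_apply, Matrix.mulVec, dotProduct, ← e.symm.sum_comp]
  rfl

/-- A reachable nonnegative function is computed by a network whose width is exactly `k`: the
last hidden layer is padded with idle neurons. -/
lemma Reach.exists_net {g : ι → (Fin d → ℝ) → ℝ} (hg : Reach S k g) (hk : 0 < k) (i : ι)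
    (hi : ∀ x ∈ S, 0 ≤ g i x) :
    ∃ f : ReLUNet d, f.width = k ∧ ∀ x ∈ S, f.eval x = g i x := by
  obtain ⟨n, e, he⟩ := hg
  obtain ⟨f, hf, hfe⟩ := he
    (.hidden (m := k) (Matrix.of fun _ j => if j = e i then 1 else 0) 0
      (.output (Matrix.of fun _ j => if j = ⟨0, hk⟩ then 1 else 0) 0))
    (by simp [ReLUNet.width])
  refine ⟨f, hf, fun x hx => ?_⟩
  rw [hfe x hx]
  simp [ReLUNet.eval, Matrix.mulVec, dotProduct, hi x hx]

/-- The registers of the memorizing network: `m` nonnegative coordinates `y`, and three work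
registers. -/
def registers {m : ℕ} (y : Fin m → (Fin d → ℝ) → ℝ) (A D P : (Fin d → ℝ) → ℝ) :
    Fin m ⊕ Fin 3 → (Fin d → ℝ) → ℝ :=
  Sum.elim y ![A, D, P]

/-- One layer that keeps the coordinates and replaces each work register by the ReLU of an
affine combination of the registers. -/
lemma Reach.update {m : ℕ} {y : Fin m → (Fin d → ℝ) → ℝ} {A D P A' D' P' : (Fin d → ℝ) → ℝ}
    (h : Reach S k (registers y A D P)) (hk : m + 3 ≤ k) (hy : ∀ j, ∀ x ∈ S, 0 ≤ y j x)
    (H : ∀ F ∈ ({A', D', P'} : Set ((Fin d → ℝ) → ℝ)), ∃ (w : Fin m → ℝ) (a b c e : ℝ),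
      ∀ x ∈ S, F x = max 0 (∑ j, w j * y j x + a * A x + b * D x + c * P x + e)) :
    Reach S k (registers y A' D' P') := by
  refine h.layer (by simpa using hk) ?_
  have key : ∀ F ∈ ({A', D', P'} : Set ((Fin d → ℝ) → ℝ)), ∃ (w : Fin m ⊕ Fin 3 → ℝ) (b : ℝ),
      ∀ x ∈ S, F x = max 0 (∑ j, w j * registers y A D P j x + b) := by
    intro F hF
    obtain ⟨w, a, b, c, e, hw⟩ := H F hF
    refine ⟨Sum.elim w ![a, b, c], e, fun x hx => ?_⟩
    rw [hw x hx]
    simp [registers, Fin.sum_univ_three, add_assoc]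
  rintro (j | j)
  · refine ⟨Pi.single (Sum.inl j) 1, 0, fun x hx => ?_⟩
    simp [registers, Pi.single_apply, hy j x hx]
  · fin_cases j
    · exact key A' (by simp)
    · exact key D' (by simp)
    · exact key P' (by simp)

/-- Two layers add `|y j - c|` to the second work register, because
`|t| = 2 * max 0 t - t`. -/
lemma Reach.add_abs {m : ℕ} {y : Fin m → (Fin d → ℝ) → ℝ} {A D P : (Fin d → ℝ) → ℝ}
    (h : Reach S k (registers y A D P)) (hk : m + 3 ≤ k) (hy : ∀ j, ∀ x ∈ S, 0 ≤ y j x)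
    (hA : ∀ x ∈ S, 0 ≤ A x) (hD : ∀ x ∈ S, 0 ≤ D x) (j : Fin m) (c : ℝ) :
    Reach S k (registers y A (fun x => D x + |y j x - c|) 0) := by
  have h1 : Reach S k (registers y A D (fun x => max 0 (y j x - c))) := by
    refine h.update hk hy ?_
    rintro F (rfl | rfl | rfl)
    · exact ⟨0, 1, 0, 0, 0, fun x hx => by simp [hA x hx]⟩
    · exact ⟨0, 0, 1, 0, 0, fun x hx => by simp [hD x hx]⟩
    · exact ⟨Pi.single j 1, 0, 0, 0, -c, fun x _ => by simp [Pi.single_apply, sub_eq_add_neg]⟩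
  refine h1.update hk hy ?_
  rintro F (rfl | rfl | rfl)
  · exact ⟨0, 1, 0, 0, 0, fun x hx => by simp [hA x hx]⟩
  · refine ⟨Pi.single j (-1), 0, 1, 2, c, fun x hx => ?_⟩
    have : |y j x - c| = 2 * max 0 (y j x - c) - (y j x - c) := by
      rcases le_total 0 (y j x - c) with h | h
      · rw [abs_of_nonneg h, max_eq_right h]; ring
      · rw [abs_of_nonpos h, max_eq_left h]; ring
    have hs : ∑ i, (Pi.single j (-1) : Fin m → ℝ) i * y i x + 0 * A x + 1 * D x +
        2 * max 0 (y j x - c) + c = D x + |y j x - c| := by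
      rw [this]
      simp only [Pi.single_apply, ite_mul, zero_mul, Finset.sum_ite_eq', Finset.mem_univ, if_true]
      ring
    have h0 := hD x hx
    rw [hs, max_eq_right (by positivity)]
  · exact ⟨0, 0, 0, 0, 0, fun x hx => by simp⟩

lemma Reach.add_l1_dist {m : ℕ} {y : Fin m → (Fin d → ℝ) → ℝ} {A P : (Fin d → ℝ) → ℝ}
    (h : Reach S k (registers y A 0 P)) (hk : m + 3 ≤ k) (hy : ∀ j, ∀ x ∈ S, 0 ≤ y j x)
    (hA : ∀ x ∈ S, 0 ≤ A x) (c : Fin m → ℝ) :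
    ∃ P', Reach S k (registers y A (fun x => ∑ j, |y j x - c j|) P') := by
  classical
  suffices ∀ s : Finset (Fin m),
      ∃ P', Reach S k (registers y A (fun x => ∑ j ∈ s, |y j x - c j|) P') from this _
  intro s
  induction s using Finset.induction_on with
  | empty => simp only [Finset.sum_empty]; exact ⟨P, h⟩
  | insert j s hj ih =>
    obtain ⟨P', ih⟩ := ih
    have := ih.add_abs hk hy hA (fun x _ => Finset.sum_nonneg fun _ _ => abs_nonneg _) j (c j)
    refine ⟨0, ?_⟩
    simpa only [Finset.sum_insert hj, add_comm] using this

/-- A block of layers that updates the first work register to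
`max A (v - K * max 0 (‖y - c‖₁ - τ))`. -/
lemma Reach.max_bump {m : ℕ} {y : Fin m → (Fin d → ℝ) → ℝ} {A P : (Fin d → ℝ) → ℝ}
    (h : Reach S k (registers y A 0 P)) (hk : m + 3 ≤ k) (hy : ∀ j, ∀ x ∈ S, 0 ≤ y j x)
    (hA : ∀ x ∈ S, 0 ≤ A x) (c : Fin m → ℝ) (τ K v : ℝ) :
    ∃ P', Reach S k (registers y
      (fun x => max (A x) (v - K * max 0 (∑ j, |y j x - c j| - τ))) 0 P') := by
  obtain ⟨P₁, h₁⟩ := h.add_l1_dist hk hy hA c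
  have h₂ : Reach S k (registers y A 0 (fun x => max 0 (∑ j, |y j x - c j| - τ))) := by
    refine h₁.update hk hy ?_
    rintro F (rfl | rfl | rfl)
    · exact ⟨0, 1, 0, 0, 0, fun x hx => by simp [hA x hx]⟩
    · exact ⟨0, 0, 0, 0, 0, fun x hx => by simp⟩
    · exact ⟨0, 0, 1, 0, -τ, fun x _ => by simp [sub_eq_add_neg]⟩
  have h₃ : Reach S k (registers y A 0
      (fun x => max 0 (v - K * max 0 (∑ j, |y j x - c j| - τ) - A x))) := by
    refine h₂.update hk hy ?_
    rintro F (rfl | rfl | rfl)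
    · exact ⟨0, 1, 0, 0, 0, fun x hx => by simp [hA x hx]⟩
    · exact ⟨0, 0, 0, 0, 0, fun x hx => by simp⟩
    · refine ⟨0, -1, 0, -K, v, fun x _ => ?_⟩
      simp only [Pi.zero_apply, zero_mul, Finset.sum_const_zero]
      ring_nf
  refine ⟨0, h₃.update hk hy ?_⟩
  rintro F (rfl | rfl | rfl)
  · refine ⟨0, 1, 0, 1, 0, fun x hx => ?_⟩
    have h0 := hA x hx
    have : max (A x) (v - K * max 0 (∑ j, |y j x - c j| - τ)) =
        A x + max 0 (v - K * max 0 (∑ j, |y j x - c j| - τ) - A x) := by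
      rw [← max_add_add_left]; simp
    have hs : ∑ j, (0 : Fin m → ℝ) j * y j x + 1 * A x + 0 * (0 : (Fin d → ℝ) → ℝ) x +
        1 * max 0 (v - K * max 0 (∑ j, |y j x - c j| - τ) - A x) + 0 =
        max (A x) (v - K * max 0 (∑ j, |y j x - c j| - τ)) := by
      rw [this]
      simp
    rw [hs, max_eq_right (le_max_of_le_left h0)]
  · exact ⟨0, 0, 0, 0, 0, fun x hx => by simp⟩
  · exact ⟨0, 0, 0, 0, 0, fun x hx => by simp⟩

/-- The maximum of finitely many truncated `l_1` bumps in `m` reachable coordinates is computed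
by a network of width `k ≥ m + 3`. -/
lemma exists_net_eq_sup_bumps {m : ℕ} {α : Type} (hk : m + 3 ≤ k)
    (L : Fin m → Fin d → ℝ) (B : ℝ) (hB : ∀ j, ∀ x ∈ S, 0 ≤ L j ⬝ᵥ x + B)
    (l : List α) (c : α → Fin m → ℝ) (τ K : ℝ) (v : α → ℝ) :
    ∃ f : ReLUNet d, f.width = k ∧ ∀ x ∈ S, f.eval x =
      l.foldr (fun z r => max r (v z - K * max 0 (∑ j, |L j ⬝ᵥ x - c z j| - τ))) 0 := by
  set y : Fin m → (Fin d → ℝ) → ℝ := fun j x => L j ⬝ᵥ x + B with hy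
  have h₀ : Reach S k (registers y 0 0 0) := by
    refine (reach_coordinates S k).layer (by simpa using hk) ?_
    rintro (j | j)
    · exact ⟨L j, B, fun x hx => by
        have := hB j x hx
        simp only [dotProduct] at this
        simp [registers, hy, dotProduct, this]⟩
    · exact ⟨0, 0, fun x hx => by fin_cases j <;> simp [registers]⟩
  have key : ∃ P, Reach S k (registers y (fun x =>
      l.foldr (fun z r => max r (v z - K * max 0 (∑ j, |L j ⬝ᵥ x - c z j| - τ))) 0) 0 P) ∧
      ∀ x ∈ S, 0 ≤
        l.foldr (fun z r => max r (v z - K * max 0 (∑ j, |L j ⬝ᵥ x - c z j| - τ))) 0 := by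
    induction l with
    | nil => simp only [List.foldr_nil]; exact ⟨0, h₀, fun _ _ => le_rfl⟩
    | cons z l ih =>
      obtain ⟨P, hP, hn⟩ := ih
      obtain ⟨P', hP'⟩ := hP.max_bump hk hB hn (fun j => c z j + B) τ K (v z)
      refine ⟨P', by simpa [hy] using hP', fun x hx => ?_⟩
      exact le_max_of_le_left (hn x hx)
  obtain ⟨P, hP, hn⟩ := key
  exact hP.exists_net (by omega) (Sum.inr 0) hn

lemma foldr_max_eq {α : Type} (l : List α) (F : α → ℝ) (v : ℝ) (hv : 0 ≤ v)
    (hle : ∀ z ∈ l, F z ≤ v) (hex : ∃ z ∈ l, F z = v) :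
    l.foldr (fun z r => max r (F z)) 0 = v := by
  have h0 : ∀ l : List α, (∀ z ∈ l, F z ≤ v) → l.foldr (fun z r => max r (F z)) 0 ≤ v := by
    intro l
    induction l with
    | nil => simp [hv]
    | cons a l ih =>
      intro h
      exact max_le (ih fun z hz => h z (List.mem_cons_of_mem _ hz)) (h a List.mem_cons_self)
  refine le_antisymm (h0 l hle) ?_
  obtain ⟨z, hz, rfl⟩ := hex
  clear hle h0 hv
  induction l with
  | nil => simp at hz
  | cons a l ih =>
    rcases List.mem_cons.1 hz with rfl | hz
    · exact le_max_right _ _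
    · exact le_max_of_le_left (ih hz)

/-- Memorization after a linear map `L` into `ℝ^m`: if the images of the regions `U z` lie in
`l_1` balls of radius `τ`, and the centres of such balls with different labels are more than
`2 * τ` apart, then width `m + 3` is enough. -/
lemma exists_net_of_l1_separated {m : ℕ} (hk : m + 3 ≤ k)
    (D : Finset ((Fin d → ℝ) × ℕ)) (U : (Fin d → ℝ) × ℕ → Set (Fin d → ℝ))
    (L : Fin m → Fin d → ℝ) (τ : ℝ)
    (hU : ∀ z ∈ D, ∀ x ∈ U z, ∑ j, |L j ⬝ᵥ (x - z.1)| ≤ τ)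
    (hsep : ∀ z ∈ D, ∀ w ∈ D, z.2 ≠ w.2 → 2 * τ < ∑ j, |L j ⬝ᵥ (z.1 - w.1)|) :
    ∃ f : ReLUNet d, f.width = k ∧ ∀ z ∈ D, ∀ x ∈ U z, f.eval x = (z.2 : ℝ) := by
  classical
  -- a uniform margin in the strict separation
  obtain ⟨γ, hγ, hγs⟩ : ∃ γ > 0, ∀ z ∈ D, ∀ w ∈ D, z.2 ≠ w.2 →
      2 * τ + γ ≤ ∑ j, |L j ⬝ᵥ (z.1 - w.1)| := by
    have : ∀ s : Finset (((Fin d → ℝ) × ℕ) × ((Fin d → ℝ) × ℕ)),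
        (∀ q ∈ s, 2 * τ < ∑ j, |L j ⬝ᵥ (q.1.1 - q.2.1)|) →
        ∃ γ > 0, ∀ q ∈ s, 2 * τ + γ ≤ ∑ j, |L j ⬝ᵥ (q.1.1 - q.2.1)| := by
      intro s
      induction s using Finset.induction_on with
      | empty => exact fun _ => ⟨1, one_pos, by simp⟩
      | insert q s _ ih =>
        intro h
        obtain ⟨γ, hγ, hs⟩ := ih fun q hq => h q (Finset.mem_insert_of_mem hq)
        have hq := h q (Finset.mem_insert_self _ _)
        refine ⟨min γ (∑ j, |L j ⬝ᵥ (q.1.1 - q.2.1)| - 2 * τ), lt_min hγ (by linarith), ?_⟩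
        intro q' hq'
        rcases Finset.mem_insert.1 hq' with rfl | hq'
        · linarith [min_le_right γ (∑ j, |L j ⬝ᵥ (q'.1.1 - q'.2.1)| - 2 * τ)]
        · linarith [min_le_left γ (∑ j, |L j ⬝ᵥ (q.1.1 - q.2.1)| - 2 * τ), hs q' hq']
    obtain ⟨γ, hγ, h⟩ := this ((D ×ˢ D).filter fun q => q.1.2 ≠ q.2.2) (by
      intro q hq
      simp only [Finset.mem_filter, Finset.mem_product] at hq
      exact hsep _ hq.1.1 _ hq.1.2 hq.2)
    exact ⟨γ, hγ, fun z hz w hw hne => h (z, w) (by simp [hz, hw, hne])⟩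
  -- a slope that brings every bump down to zero across the margin
  obtain ⟨K, hK0, hK⟩ : ∃ K : ℝ, 0 ≤ K ∧ ∀ z ∈ D, (z.2 : ℝ) ≤ K * γ := by
    refine ⟨(∑ z ∈ D, (z.2 : ℝ)) / γ, by positivity, fun z hz => ?_⟩
    rw [div_mul_cancel₀ _ hγ.ne']
    exact Finset.single_le_sum (f := fun z : (Fin d → ℝ) × ℕ => (z.2 : ℝ))
      (fun _ _ => Nat.cast_nonneg _) hz
  let S : Set (Fin d → ℝ) := {x | ∃ z ∈ D, x ∈ U z}
  obtain ⟨B, hB⟩ : ∃ B : ℝ, ∀ j, ∀ x ∈ S, 0 ≤ L j ⬝ᵥ x + B := by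
    refine ⟨τ + ∑ z ∈ D, ∑ j, |L j ⬝ᵥ z.1|, ?_⟩
    rintro j x ⟨z, hz, hx⟩
    have h1 := hU z hz x hx
    have h2 : |L j ⬝ᵥ (x - z.1)| ≤ _ := Finset.single_le_sum
      (f := fun j => |L j ⬝ᵥ (x - z.1)|) (fun _ _ => abs_nonneg _) (Finset.mem_univ j)
    have h3 : |L j ⬝ᵥ z.1| ≤ _ := Finset.single_le_sum
      (f := fun j => |L j ⬝ᵥ z.1|) (fun _ _ => abs_nonneg _) (Finset.mem_univ j)
    have h4 : ∑ j, |L j ⬝ᵥ z.1| ≤ _ := Finset.single_le_sum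
      (f := fun z : (Fin d → ℝ) × ℕ => ∑ j, |L j ⬝ᵥ z.1|)
      (fun _ _ => Finset.sum_nonneg fun _ _ => abs_nonneg _) hz
    have h5 := neg_abs_le (L j ⬝ᵥ (x - z.1))
    have h6 := neg_abs_le (L j ⬝ᵥ z.1)
    have h7 : L j ⬝ᵥ (x - z.1) = L j ⬝ᵥ x - L j ⬝ᵥ z.1 := dotProduct_sub _ _ _
    linarith
  obtain ⟨f, hf, hfe⟩ := exists_net_eq_sup_bumps hk L B hB D.toList
    (fun z j => L j ⬝ᵥ z.1) τ K (fun z => (z.2 : ℝ))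
  refine ⟨f, hf, fun z hz x hx => ?_⟩
  rw [hfe x ⟨z, hz, hx⟩]
  have hdist : ∀ w : (Fin d → ℝ) × ℕ,
      ∑ j, |L j ⬝ᵥ x - L j ⬝ᵥ w.1| = ∑ j, |L j ⬝ᵥ (x - w.1)| := by
    simp [dotProduct_sub]
  refine foldr_max_eq D.toList _ _ (Nat.cast_nonneg _) ?_ ⟨z, by simpa using hz, ?_⟩
  · intro w hw
    rw [Finset.mem_toList] at hw
    rw [hdist]
    have hmax := le_max_left 0 (∑ j, |L j ⬝ᵥ (x - w.1)| - τ)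
    by_cases hne : z.2 = w.2
    · rw [hne]
      nlinarith [mul_nonneg hK0 hmax]
    · have h1 := hγs z hz w hw hne
      have h2 : ∑ j, |L j ⬝ᵥ (z.1 - w.1)| ≤
          ∑ j, |L j ⬝ᵥ (x - z.1)| + ∑ j, |L j ⬝ᵥ (x - w.1)| := by
        rw [← Finset.sum_add_distrib]
        refine Finset.sum_le_sum fun j _ => ?_
        have : L j ⬝ᵥ (z.1 - w.1) = -(L j ⬝ᵥ (x - z.1)) + L j ⬝ᵥ (x - w.1) := by
          simp only [dotProduct_sub]; ring
        rw [this]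
        exact (abs_add_le _ _).trans (by rw [abs_neg])
      have h3 := hU z hz x hx
      have h4 : γ ≤ max 0 (∑ j, |L j ⬝ᵥ (x - w.1)| - τ) :=
        le_max_of_le_right (by linarith)
      have h5 := mul_le_mul_of_nonneg_left h4 hK0
      have h6 := hK w hw
      have h7 : (0 : ℝ) ≤ z.2 := Nat.cast_nonneg _
      linarith
  · rw [hdist, max_eq_left (by linarith [hU z hz x hx])]
    simp

end

/-! ### Gaussian random projections -/

section

open MeasureTheory ProbabilityTheory

variable {m d : ℕ}

lemma stdGaussian_map_inner (v : EuclideanSpace ℝ (Fin d)) :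
    (stdGaussian (EuclideanSpace ℝ (Fin d))).map (fun g => inner ℝ v g) =
      gaussianReal 0 (‖v‖ ^ 2).toNNReal := by
  have h := IsGaussian.map_eq_gaussianReal (μ := stdGaussian (EuclideanSpace ℝ (Fin d)))
    (innerSL ℝ v)
  rw [integral_strongDual_stdGaussian, variance_dual_stdGaussian, innerSL_apply_norm] at h
  exact h

lemma integral_exp_inner_stdGaussian (v : EuclideanSpace ℝ (Fin d)) (c : ℝ) :
    ∫ g, Real.exp (c * inner ℝ v g) ∂(stdGaussian (EuclideanSpace ℝ (Fin d))) =
      Real.exp (c ^ 2 * ‖v‖ ^ 2 / 2) := by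
  have := mgf_gaussianReal (stdGaussian_map_inner v) c
  rw [mgf] at this
  rw [this, Real.coe_toNNReal _ (by positivity)]
  ring_nf

lemma integrable_exp_inner_stdGaussian (v : EuclideanSpace ℝ (Fin d)) (c : ℝ) :
    Integrable (fun g => Real.exp (c * inner ℝ v g))
      (stdGaussian (EuclideanSpace ℝ (Fin d))) := by
  -- the integral of a non-integrable function is `0` by convention
  by_contra h
  have := integral_exp_inner_stdGaussian v c
  rw [integral_undef h] at this
  exact (Real.exp_pos _).ne this

lemma integral_exp_neg_mul_abs {c : ℝ} (hc : 0 < c) :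
    ∫ t : ℝ, Real.exp (-(c * |t|)) = 2 / c := by
  have h := integral_comp_abs (f := fun t : ℝ => Real.exp (-(c * t)))
  rw [h]
  have := integral_exp_mul_Ioi (a := -c) (by linarith) 0
  simp only [neg_mul, mul_zero, Real.exp_zero] at this
  rw [this]
  field_simp

lemma integrable_exp_neg_mul_abs {c : ℝ} (hc : 0 < c) :
    Integrable (fun t : ℝ => Real.exp (-(c * |t|))) := by
  -- the integral of a non-integrable function is `0` by convention
  by_contra h
  have := integral_exp_neg_mul_abs hc
  rw [integral_undef h] at this
  exact (div_pos two_pos hc).ne this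

/-- The small-ball estimate for one Gaussian coordinate, in exponential form: the density
is at most `1 / (√(2π) ‖v‖)`. -/
lemma integral_exp_neg_abs_inner_stdGaussian_le (v : EuclideanSpace ℝ (Fin d)) (hv : v ≠ 0)
    {c : ℝ} (hc : 0 < c) :
    ∫ g, Real.exp (-(c * |inner ℝ v g|)) ∂(stdGaussian (EuclideanSpace ℝ (Fin d))) ≤
      1 / (c * ‖v‖) := by
  have hv' : 0 < ‖v‖ := norm_pos_iff.2 hv
  have hvar : (‖v‖ ^ 2).toNNReal ≠ 0 := by
    rw [ne_eq, Real.toNNReal_eq_zero, not_le]; positivity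
  have h1 : ∫ g, Real.exp (-(c * |inner ℝ v g|)) ∂(stdGaussian (EuclideanSpace ℝ (Fin d))) =
      ∫ t, Real.exp (-(c * |t|)) ∂(gaussianReal 0 (‖v‖ ^ 2).toNNReal) := by
    rw [← stdGaussian_map_inner v, integral_map (by fun_prop) (by fun_prop)]
  rw [h1, integral_gaussianReal_eq_integral_smul hvar]
  have h2 : ∀ t : ℝ, gaussianPDFReal 0 (‖v‖ ^ 2).toNNReal t • Real.exp (-(c * |t|)) ≤
      1 / (2 * ‖v‖) * Real.exp (-(c * |t|)) := by
    intro t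
    refine mul_le_mul_of_nonneg_right ?_ (Real.exp_pos _).le
    rw [gaussianPDFReal, Real.coe_toNNReal _ (by positivity)]
    have h3 : 2 * ‖v‖ ≤ √(2 * Real.pi * ‖v‖ ^ 2) := by
      refine Real.le_sqrt_of_sq_le ?_
      nlinarith [Real.pi_gt_three, sq_nonneg ‖v‖]
    calc (√(2 * Real.pi * ‖v‖ ^ 2))⁻¹ * Real.exp (-(t - 0) ^ 2 / (2 * ‖v‖ ^ 2))
        ≤ (√(2 * Real.pi * ‖v‖ ^ 2))⁻¹ * 1 := by
          gcongr
          rw [Real.exp_le_one_iff]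
          have : 0 ≤ (t - 0) ^ 2 / (2 * ‖v‖ ^ 2) := by positivity
          rw [neg_div]; linarith
      _ ≤ 1 / (2 * ‖v‖) := by
          rw [mul_one, ← one_div]
          exact one_div_le_one_div_of_le (by positivity) h3
  have hint : Integrable (fun t : ℝ => 1 / (2 * ‖v‖) * Real.exp (-(c * |t|))) :=
    (integrable_exp_neg_mul_abs hc).const_mul _
  calc ∫ t, gaussianPDFReal 0 (‖v‖ ^ 2).toNNReal t • Real.exp (-(c * |t|))
      ≤ ∫ t, 1 / (2 * ‖v‖) * Real.exp (-(c * |t|)) := by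
        refine integral_mono_of_nonneg (ae_of_all _ fun t => ?_) hint (ae_of_all _ h2)
        exact mul_nonneg (gaussianPDFReal_nonneg _ _ _) (Real.exp_pos _).le
    _ = 1 / (c * ‖v‖) := by
        rw [integral_const_mul, integral_exp_neg_mul_abs hc]
        field_simp

/-- The law of an `m × d` matrix with independent standard Gaussian entries, given by rows. -/
noncomputable def gaussianRows (m d : ℕ) : Measure (Fin m → EuclideanSpace ℝ (Fin d)) :=
  Measure.pi fun _ => stdGaussian (EuclideanSpace ℝ (Fin d))

instance : IsProbabilityMeasure (gaussianRows m d) := by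
  unfold gaussianRows; infer_instance

/-- The bilinear form `∑ j, s j * ⟪v, G j⟫` is Gaussian with variance `(∑ j, s j ^ 2) * ‖v‖ ^ 2`. -/
lemma integral_exp_bilin (s : Fin m → ℝ) (v : EuclideanSpace ℝ (Fin d)) (c : ℝ) :
    Integrable (fun G => Real.exp (c * ∑ j, s j * inner ℝ v (G j))) (gaussianRows m d) ∧
    ∫ G, Real.exp (c * ∑ j, s j * inner ℝ v (G j)) ∂(gaussianRows m d) =
      Real.exp (c ^ 2 * (∑ j, s j ^ 2) * ‖v‖ ^ 2 / 2) := by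
  have h : (fun G : Fin m → EuclideanSpace ℝ (Fin d) =>
      Real.exp (c * ∑ j, s j * inner ℝ v (G j))) =
      fun G => ∏ j, Real.exp ((c * s j) * inner ℝ v (G j)) := by
    funext G
    rw [← Real.exp_sum, Finset.mul_sum]
    simp only [mul_assoc]
  rw [h]
  constructor
  · exact Integrable.fintype_prod (f := fun j g => Real.exp ((c * s j) * inner ℝ v g))
      fun j => integrable_exp_inner_stdGaussian v _
  · rw [gaussianRows, integral_fintype_prod_eq_prod
      (f := fun j g => Real.exp ((c * s j) * inner ℝ v g))]
    simp only [integral_exp_inner_stdGaussian]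
    rw [← Real.exp_sum, Finset.mul_sum, Finset.sum_mul, Finset.sum_div]
    simp only [mul_pow]

lemma integral_exp_neg_l1_le (v : EuclideanSpace ℝ (Fin d)) (hv : v ≠ 0) {c : ℝ} (hc : 0 < c) :
    Integrable (fun G => Real.exp (-(c * ∑ j, |inner ℝ v (G j)|))) (gaussianRows m d) ∧
    ∫ G, Real.exp (-(c * ∑ j, |inner ℝ v (G j)|)) ∂(gaussianRows m d) ≤
      (1 / (c * ‖v‖)) ^ m := by
  have h : (fun G : Fin m → EuclideanSpace ℝ (Fin d) =>
      Real.exp (-(c * ∑ j, |inner ℝ v (G j)|))) =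
      fun G => ∏ j, Real.exp (-(c * |inner ℝ v (G j)|)) := by
    funext G
    rw [← Real.exp_sum, Finset.mul_sum, Finset.sum_neg_distrib]
  rw [h]
  constructor
  · refine Integrable.fintype_prod (f := fun _ g => Real.exp (-(c * |inner ℝ v g|))) fun _ => ?_
    refine (integrable_const (1 : ℝ)).mono' (by fun_prop) (ae_of_all _ fun g => ?_)
    rw [Real.norm_of_nonneg (Real.exp_pos _).le, Real.exp_le_one_iff]
    have : 0 ≤ c * |inner ℝ v g| := by positivity
    linarith
  · rw [gaussianRows, integral_fintype_prod_eq_prod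
      (f := fun _ g => Real.exp (-(c * |inner ℝ v g|)))]
    rw [Finset.prod_const, Finset.card_univ, Fintype.card_fin]
    exact pow_le_pow_left₀ (integral_nonneg fun _ => (Real.exp_pos _).le)
      (integral_exp_neg_abs_inner_stdGaussian_le v hv hc) m

end

section

open MeasureTheory ProbabilityTheory

/-- The sign `±1` encoded by a Boolean. -/
def boolSign (b : Bool) : ℝ := if b then 1 else -1

lemma boolSign_sq (b : Bool) : boolSign b ^ 2 = 1 := by cases b <;> simp [boolSign]

lemma exists_boolSign_mul_eq_abs (t : ℝ) : ∃ b, boolSign b * t = |t| := by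
  rcases le_total 0 t with h | h
  · exact ⟨true, by simp [boolSign, abs_of_nonneg h]⟩
  · exact ⟨false, by simp [boolSign, abs_of_nonpos h]⟩

variable {m d : ℕ}

/-- The first-moment argument.  With positive probability a Gaussian matrix has
`‖G‖_{∞ → 1} < a` and, at the same time, `‖G v‖₁ > T` for all `v` in the finite set `V`. -/
lemma exists_gaussian_rows (hm : 0 < m) (hd : 0 < d) (V : Finset (EuclideanSpace ℝ (Fin d)))
    {δ a T : ℝ} (hδ : 0 < δ) (hV : ∀ v ∈ V, δ ≤ ‖v‖) (hT : 0 < T)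
    (ha0 : 0 < a) (ha : a ^ 2 = 4 * (m * d * (m + d)))
    (hcard : V.card * (Real.exp 1 * T / (m * δ)) ^ m ≤ 1 / 2) :
    ∃ G : Fin m → EuclideanSpace ℝ (Fin d),
      (∀ (s : Fin m → Bool) (t : Fin d → Bool),
        ∑ j, boolSign (s j) * inner ℝ (WithLp.toLp 2 fun i => boolSign (t i)) (G j) < a) ∧
      ∀ v ∈ V, T < ∑ j, |inner ℝ v (G j)| := by
  have hm' : (0 : ℝ) < m := by exact_mod_cast hm
  have hd' : (0 : ℝ) < d := by exact_mod_cast hd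
  let t2 : (Fin d → Bool) → EuclideanSpace ℝ (Fin d) :=
    fun t => WithLp.toLp 2 fun i => boolSign (t i)
  have ht2 : ∀ t, ‖t2 t‖ ^ 2 = d := by
    intro t
    simp [t2, EuclideanSpace.norm_sq_eq, boolSign_sq]
  -- the optimal exponents in the two Chernoff bounds
  set l : ℝ := a / (m * d) with hl
  set c : ℝ := m / T with hc
  have hc0 : 0 < c := by positivity
  let Φ₁ : (Fin m → EuclideanSpace ℝ (Fin d)) → ℝ := fun G =>
    ∑ q : (Fin m → Bool) × (Fin d → Bool), Real.exp (-(l * a)) *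
      Real.exp (l * ∑ j, boolSign (q.1 j) * inner ℝ (t2 q.2) (G j))
  let Φ₂ : (Fin m → EuclideanSpace ℝ (Fin d)) → ℝ := fun G =>
    ∑ v ∈ V, Real.exp (c * T) * Real.exp (-(c * ∑ j, |inner ℝ v (G j)|))
  have hV0 : ∀ v ∈ V, v ≠ 0 := fun v hv => norm_pos_iff.1 (hδ.trans_le (hV v hv))
  have i1 : Integrable Φ₁ (gaussianRows m d) :=
    integrable_finsetSum _ fun q _ => ((integral_exp_bilin _ _ _).1).const_mul _
  have i2 : Integrable Φ₂ (gaussianRows m d) :=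
    integrable_finsetSum _ fun v hv => ((integral_exp_neg_l1_le v (hV0 v hv) hc0).1).const_mul _
  have e1 : ∫ G, Φ₁ G ∂(gaussianRows m d) < 1 / 2 := by
    have : ∀ q : (Fin m → Bool) × (Fin d → Bool), ∫ G, Real.exp (-(l * a)) *
        Real.exp (l * ∑ j, boolSign (q.1 j) * inner ℝ (t2 q.2) (G j)) ∂(gaussianRows m d) =
        Real.exp (-2) ^ (m + d) := by
      intro q
      rw [integral_const_mul, (integral_exp_bilin _ _ _).2, ht2, ← Real.exp_add, ← Real.exp_nat_mul]
      congr 1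
      simp only [boolSign_sq, Finset.sum_const, Finset.card_univ, Fintype.card_fin, nsmul_eq_mul,
        mul_one]
      have h1 : l ^ 2 * m * d / 2 = a ^ 2 / (2 * (m * d)) := by rw [hl]; field_simp
      have h2 : l * a = a ^ 2 / (m * d) := by rw [hl]; field_simp
      rw [h1, h2, ha]
      push_cast
      field_simp
      ring
    simp only [Φ₁]
    rw [integral_finsetSum _ fun q _ => ((integral_exp_bilin _ _ _).1).const_mul _]
    simp only [this, Finset.sum_const, Finset.card_univ, Fintype.card_prod, Fintype.card_fun,
      Fintype.card_bool, Fintype.card_fin, nsmul_eq_mul]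
    push_cast
    rw [← pow_add, ← mul_pow]
    have h4 : Real.exp (-2) < 1 / 4 := by
      have h5 : (2 : ℝ) < Real.exp 1 := by linarith [Real.exp_one_gt_d9]
      have h6 : Real.exp 2 = Real.exp 1 * Real.exp 1 := by rw [← Real.exp_add]; norm_num
      rw [Real.exp_neg, ← one_div]
      exact one_div_lt_one_div_of_lt (by norm_num) (by nlinarith)
    have h7 : 2 * Real.exp (-2) < 1 / 2 := by linarith
    have h8 : 0 ≤ 2 * Real.exp (-2) := by positivity
    calc (2 * Real.exp (-2)) ^ (m + d) ≤ (2 * Real.exp (-2)) ^ 1 :=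
          pow_le_pow_of_le_one h8 (by linarith) (by omega)
      _ < 1 / 2 := by rw [pow_one]; exact h7
  have e2 : ∫ G, Φ₂ G ∂(gaussianRows m d) ≤ 1 / 2 := by
    simp only [Φ₂]
    rw [integral_finsetSum _ fun v hv =>
      ((integral_exp_neg_l1_le v (hV0 v hv) hc0).1).const_mul _]
    refine le_trans ?_ hcard
    rw [← nsmul_eq_mul]
    refine Finset.sum_le_card_nsmul _ _ _ fun v hv => ?_
    rw [integral_const_mul]
    have hcT : c * T = m := by rw [hc]; field_simp
    have h9 : Real.exp 1 * T / (m * δ) = Real.exp 1 * (1 / (c * δ)) := by rw [hc]; field_simp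
    rw [h9, mul_pow, ← Real.exp_nat_mul, mul_one, hcT]
    refine mul_le_mul_of_nonneg_left ?_ (Real.exp_pos _).le
    refine (integral_exp_neg_l1_le v (hV0 v hv) hc0).2.trans ?_
    have := hV v hv
    gcongr
  obtain ⟨G, hG⟩ := exists_le_integral (i1.add i2)
  have hG1 : Φ₁ G + Φ₂ G < 1 := by
    simp only [Pi.add_apply] at hG
    rw [integral_add i1 i2] at hG
    linarith
  have p1 : 0 ≤ Φ₁ G := Finset.sum_nonneg fun _ _ => by positivity
  have p2 : 0 ≤ Φ₂ G := Finset.sum_nonneg fun _ _ => by positivity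
  refine ⟨G, fun s t => ?_, fun v hv => ?_⟩
  · have h : Real.exp (-(l * a)) *
        Real.exp (l * ∑ j, boolSign (s j) * inner ℝ (t2 t) (G j)) ≤ Φ₁ G :=
      Finset.single_le_sum (f := fun q : (Fin m → Bool) × (Fin d → Bool) => Real.exp (-(l * a)) *
        Real.exp (l * ∑ j, boolSign (q.1 j) * inner ℝ (t2 q.2) (G j)))
        (fun _ _ => by positivity) (Finset.mem_univ (s, t))
    rw [← Real.exp_add] at h
    have h' := Real.exp_lt_one_iff.1 (h.trans_lt (by linarith))
    have hl0 : 0 < l := by positivity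
    exact lt_of_mul_lt_mul_left (by linarith) hl0.le
  · have h : Real.exp (c * T) * Real.exp (-(c * ∑ j, |inner ℝ v (G j)|)) ≤ Φ₂ G :=
      Finset.single_le_sum (f := fun v => Real.exp (c * T) *
        Real.exp (-(c * ∑ j, |inner ℝ v (G j)|))) (fun _ _ => by positivity) hv
    rw [← Real.exp_add] at h
    have h' := Real.exp_lt_one_iff.1 (h.trans_lt (by linarith))
    exact lt_of_mul_lt_mul_left (by linarith) hc0.le

/-- A bilinear form bounded on sign vectors bounds the norm from `l_∞` to `l_1`. -/
lemma sum_abs_inner_le {a σ : ℝ} (G : Fin m → EuclideanSpace ℝ (Fin d))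
    (hG : ∀ (s : Fin m → Bool) (t : Fin d → Bool),
      ∑ j, boolSign (s j) * inner ℝ (WithLp.toLp 2 fun i => boolSign (t i)) (G j) ≤ a)
    (x : EuclideanSpace ℝ (Fin d)) (hσ : 0 ≤ σ) (hx : ∀ i, |x i| ≤ σ) :
    ∑ j, |inner ℝ x (G j)| ≤ σ * a := by
  choose s hs using fun j => exists_boolSign_mul_eq_abs (inner ℝ x (G j))
  choose t ht using fun i => exists_boolSign_mul_eq_abs (∑ j, boolSign (s j) * G j i)
  refine le_trans ?_ (mul_le_mul_of_nonneg_left (hG s t) hσ)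
  have swap : ∀ y : EuclideanSpace ℝ (Fin d), ∑ j, boolSign (s j) * inner ℝ y (G j) =
      ∑ i, y i * ∑ j, boolSign (s j) * G j i := by
    intro y
    simp only [PiLp.inner_apply, Finset.mul_sum]
    rw [Finset.sum_comm]
    refine Finset.sum_congr rfl fun i _ => Finset.sum_congr rfl fun j _ => ?_
    simp only [RCLike.inner_apply, conj_trivial]
    ring
  simp only [← hs]
  rw [swap, swap, Finset.mul_sum]
  refine Finset.sum_le_sum fun i _ => ?_
  simp only [ht]
  refine (le_abs_self _).trans ?_
  rw [abs_mul]
  exact mul_le_mul_of_nonneg_right (hx i) (abs_nonneg _)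

end

/-! ### Sufficient width -/

lemma abs_apply_le_lpNorm {d : ℕ} {p : ℝ≥0∞} (hp : 1 ≤ p) (x : Fin d → ℝ) (i : Fin d) :
    |x i| ≤ lpNorm p x := by
  have : Fact (1 ≤ p) := ⟨hp⟩
  exact PiLp.norm_apply_le (WithLp.toLp p x) i

/-- If the small-ball bound for the projection to `m` dimensions beats the number of pairs of
data points, then width `m + 3` is enough. -/
lemma widthSuffices_of_card_le {N d C k m : ℕ} {δ σ : ℝ} {p : ℝ≥0∞} (hp : 1 ≤ p) (hm : 0 < m)
    (hmd : m ≤ d) (hk : m + 3 ≤ k) (hδ : 0 < δ) (hσ : 0 < σ)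
    (hN : (N : ℝ) ^ 2 * (Real.exp 1 * (2 * (σ * √(4 * (m * d * (m + d))))) / (m * δ)) ^ m ≤
      1 / 2) :
    WidthSuffices N d C k δ σ p := by
  classical
  intro D hD hsep
  have hm' : (0 : ℝ) < m := by exact_mod_cast hm
  have hd' : (0 : ℝ) < d := by exact_mod_cast hm.trans_le hmd
  set a : ℝ := √(4 * (m * d * (m + d))) with ha
  have ha0 : 0 < a := by positivity
  let V : Finset (EuclideanSpace ℝ (Fin d)) :=
    ((D ×ˢ D).filter fun q => q.1.2 ≠ q.2.2).image fun q => WithLp.toLp 2 (q.1.1 - q.2.1)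
  have hV : ∀ v ∈ V, δ ≤ ‖v‖ := by
    intro v hv
    simp only [V, Finset.mem_image, Finset.mem_filter, Finset.mem_product] at hv
    obtain ⟨q, ⟨⟨h1, h2⟩, h3⟩, rfl⟩ := hv
    exact hsep.2 ⟨_, h1, _, h2, h3, rfl⟩
  have hVc : (V.card : ℝ) ≤ (N : ℝ) ^ 2 := by
    have : V.card ≤ N ^ 2 := by
      refine Finset.card_image_le.trans ((Finset.card_filter_le _ _).trans ?_)
      rw [Finset.card_product, hD.1, sq]
    exact_mod_cast this
  obtain ⟨G, hG1, hG2⟩ := exists_gaussian_rows (m := m) hm (hm.trans_le hmd) V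
    (T := 2 * (σ * a)) hδ hV (by positivity) ha0 (Real.sq_sqrt (by positivity))
    (le_trans (mul_le_mul_of_nonneg_right hVc (by positivity)) hN)
  have hinner : ∀ (x : Fin d → ℝ) (j : Fin m),
      inner ℝ (WithLp.toLp 2 x) (G j) = (G j).ofLp ⬝ᵥ x := by
    intro x j
    simp [EuclideanSpace.inner_eq_star_dotProduct]
  refine exists_net_of_l1_separated (m := m) hk D (fun z => {x | lpNorm p (x - z.1) ≤ σ})
    (fun j => (G j).ofLp) (σ * a) ?_ ?_
  · intro z _ x hx
    simp only [← hinner]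
    exact sum_abs_inner_le G (fun s t => (hG1 s t).le) _ hσ.le
      fun i => (abs_apply_le_lpNorm hp (x - z.1) i).trans hx
  · intro z hz w hw hne
    simp only [← hinner]
    refine hG2 _ ?_
    simp only [V, Finset.mem_image, Finset.mem_filter, Finset.mem_product]
    exact ⟨(z, w), ⟨⟨hz, hw⟩, hne⟩, rfl⟩

/-- With `r = δ / (σ d)`, a target dimension `m` with `m * r ≥ 256` and `m * log r ≥ 6 * log N`
is enough.  The first condition makes the base of the small-ball bound at most `r ^ (-1/2)`. -/
lemma widthSuffices_of_log_le {N d C k m : ℕ} {δ σ : ℝ} {p : ℝ≥0∞} (hp : 1 ≤ p) (hN : 2 ≤ N)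
    (hm : 0 < m) (hmd : m ≤ d) (hk : m + 3 ≤ k) (hδ : 0 < δ) (hσ : 0 < σ)
    (h256 : 256 ≤ m * (δ / σ / d))
    (hlog : 6 * Real.log N ≤ m * Real.log (δ / σ / d)) :
    WidthSuffices N d C k δ σ p := by
  refine widthSuffices_of_card_le hp hm hmd hk hδ hσ ?_
  have hm' : (0 : ℝ) < m := by exact_mod_cast hm
  have hd' : (0 : ℝ) < d := by exact_mod_cast hm.trans_le hmd
  have hmd' : (m : ℝ) ≤ d := by exact_mod_cast hmd
  have hN' : (2 : ℝ) ≤ N := by exact_mod_cast hN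
  set r : ℝ := δ / σ / d with hr
  have hr0 : 0 < r := by positivity
  set q : ℝ := Real.exp 1 * (2 * (σ * √(4 * (m * d * (m + d))))) / (m * δ) with hq
  have hq0 : 0 < q := by positivity
  have hq2 : q ^ 2 ≤ 1 / r := by
    have he : Real.exp 1 ^ 2 ≤ 8 := by
      nlinarith [Real.exp_one_lt_d9, Real.exp_pos 1]
    have hδr : δ = r * (σ * d) := by rw [hr]; field_simp
    have h1 : q ^ 2 = Real.exp 1 ^ 2 * (16 * σ ^ 2 * d * (m + d)) / (m * δ ^ 2) := by
      rw [hq, div_pow, mul_pow, mul_pow, mul_pow, Real.sq_sqrt (by positivity)]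
      field_simp
      ring
    rw [h1, div_le_div_iff₀ (by positivity) hr0]
    calc Real.exp 1 ^ 2 * (16 * σ ^ 2 * d * (m + d)) * r
        ≤ 8 * (16 * σ ^ 2 * d * (d + d)) * r := by gcongr
      _ = 256 * (σ ^ 2 * d ^ 2 * r) := by ring
      _ ≤ m * r * (σ ^ 2 * d ^ 2 * r) := by gcongr
      _ = 1 * (m * δ ^ 2) := by rw [hδr]; ring
  have hlq : 2 * Real.log q ≤ - Real.log r := by
    have := Real.log_le_log (by positivity) hq2
    rwa [Real.log_pow, one_div, Real.log_inv, Nat.cast_ofNat] at this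
  have hN0 : (0 : ℝ) < N := by linarith
  rw [← Real.log_le_log_iff (by positivity) (by norm_num), Real.log_mul (by positivity)
    (by positivity), Real.log_pow, Real.log_pow, one_div, Real.log_inv, Nat.cast_ofNat]
  have h2 : Real.log 2 ≤ Real.log N := Real.log_le_log two_pos hN'
  nlinarith

/-- The number of extra neurons is absorbed by the constant: for `k ≥ 7` the target dimension
`k - 3` is at least `4 * k / 7`. -/
theorem widthSuffices_of_lt {N d C k : ℕ} {δ σ : ℝ} {p : ℝ≥0∞} (hp : 1 ≤ p) (hN : 2 ≤ N)
    (hkd : k < d) (hδ : 0 < δ) (hσ : 0 < σ) (hk : 7 ≤ k) (hd : (d : ℝ) < δ / σ)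
    (h : 3000 * Real.log N / (Real.log (δ / σ) - Real.log d) < (k : ℝ)) :
    WidthSuffices N d C k δ σ p := by
  obtain ⟨m, rfl⟩ : ∃ m, k = m + 3 := ⟨k - 3, by omega⟩
  have hm4 : (4 : ℝ) ≤ m := by exact_mod_cast (by omega : 4 ≤ m)
  have hN' : (2 : ℝ) ≤ N := by exact_mod_cast hN
  have hd0 : (0 : ℝ) < d := by exact_mod_cast (by omega : 0 < d)
  rw [← Real.log_div (by positivity) hd0.ne'] at h
  have hr1 : 1 < δ / σ / d := (one_lt_div hd0).2 hd
  set r : ℝ := δ / σ / d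
  have hlr : 0 < Real.log r := Real.log_pos hr1
  rw [div_lt_iff₀ hlr] at h
  push_cast at h
  have h2 : Real.log 2 ≤ Real.log N := Real.log_le_log two_pos hN'
  have hl2 : 0 < Real.log 2 := Real.log_pos one_lt_two
  refine widthSuffices_of_log_le hp hN (by omega) (by omega) le_rfl hδ hσ ?_ (by nlinarith)
  rcases le_or_gt 256 m with hm | hm
  · have : (256 : ℝ) ≤ m := by exact_mod_cast hm
    nlinarith
  · -- a small target dimension forces a large ratio `r`
    have hm' : (m : ℝ) < 256 := by exact_mod_cast hm
    have h8 : Real.log (2 ^ 8) ≤ Real.log r := by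
      rw [Real.log_pow]
      push_cast
      nlinarith
    have := (Real.log_le_log_iff (by positivity) (by positivity)).1 h8
    norm_num at this
    nlinarith

/-! ### Necessary width -/

/-- The `l_p` balls with `p ≥ 2` contain the Euclidean balls. -/
lemma lpNorm_le_lpNorm_two {d : ℕ} {p : ℝ≥0∞} (hp : 2 ≤ p) (x : Fin d → ℝ) :
    lpNorm p x ≤ lpNorm 2 x := by
  have hle : ∀ i, |x i| ≤ lpNorm 2 x := abs_apply_le_lpNorm one_le_two x
  have h0 : 0 ≤ lpNorm 2 x := norm_nonneg (WithLp.toLp 2 x)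
  rcases eq_or_ne p ∞ with rfl | hp'
  · rw [lpNorm, PiLp.norm_eq_ciSup]
    exact Real.iSup_le hle h0
  · have hq : 2 ≤ p.toReal := by
      simpa using ENNReal.toReal_mono hp' hp
    set q := p.toReal with hqdef
    have hq0 : 0 < q := by linarith
    have hsq : ∑ i, |x i| ^ 2 = lpNorm 2 x ^ 2 := by
      rw [lpNorm, EuclideanSpace.norm_sq_eq]
      simp
    have hnorm : lpNorm p x = (∑ i, |x i| ^ q) ^ (1 / q) := by
      rw [lpNorm, PiLp.norm_eq_sum hq0]
      simp [hqdef]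
    have hsplit : ∀ t : ℝ, 0 ≤ t → t ^ q = t ^ (q - 2) * t ^ 2 := by
      intro t ht
      rw [← Real.rpow_natCast t 2, ← Real.rpow_add_of_nonneg ht (by linarith) (by norm_num)]
      norm_num
    have hsum : ∑ i, |x i| ^ q ≤ lpNorm 2 x ^ q := by
      rw [hsplit _ h0, ← hsq, Finset.mul_sum]
      refine Finset.sum_le_sum fun i _ => ?_
      rw [hsplit _ (abs_nonneg _)]
      exact mul_le_mul_of_nonneg_right
        (Real.rpow_le_rpow (abs_nonneg _) (hle i) (by linarith)) (by positivity)
    rw [hnorm]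
    calc (∑ i, |x i| ^ q) ^ (1 / q) ≤ (lpNorm 2 x ^ q) ^ (1 / q) :=
          Real.rpow_le_rpow (Finset.sum_nonneg fun _ _ => by positivity) hsum (by positivity)
      _ = lpNorm 2 x := by rw [← Real.rpow_mul h0, mul_one_div_cancel hq0.ne', Real.rpow_one]

lemma lpNorm_neg {d : ℕ} {p : ℝ≥0∞} (hp : 1 ≤ p) (x : Fin d → ℝ) :
    lpNorm p (-x) = lpNorm p x := by
  have : Fact (1 ≤ p) := ⟨hp⟩
  rw [lpNorm, WithLp.toLp_neg, norm_neg, lpNorm]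

/-- The origin with label `1`, the points of `T` with label `2`, and as many further points with
label `2` as the size `N` requires. -/
lemma exists_dataset {N C d : ℕ} {δ : ℝ} (hd : 0 < d) (hC : 2 ≤ C)
    (T : Finset (Fin d → ℝ)) (hT : ∀ x ∈ T, lpNorm 2 x = δ) (hne : T.Nonempty)
    (hcard : T.card + 1 ≤ N) :
    ∃ D : Finset ((Fin d → ℝ) × ℕ), IsDataset N C D ∧ IsSeparated δ D ∧
      (0, 1) ∈ D ∧ ∀ x ∈ T, (x, 2) ∈ D := by
  classical
  let S : Set (Fin d → ℝ) := {x | δ ≤ lpNorm 2 x}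
  have hS : S.Infinite := by
    refine Set.infinite_of_injective_forall_mem
      (f := fun n : ℕ => (Pi.single ⟨0, hd⟩ (δ + n) : Fin d → ℝ)) ?_ ?_
    · intro a b hab
      simpa using Pi.single_injective _ hab
    · intro n
      refine le_trans ?_ (abs_apply_le_lpNorm one_le_two _ ⟨0, hd⟩)
      rw [Pi.single_eq_same]
      exact le_trans (by simp) (le_abs_self _)
  obtain ⟨u, hu, huc⟩ := (hS.sdiff T.finite_toSet).exists_subset_card_eq (N - 1 - T.card)
  have hdisj : Disjoint T u := by
    rw [Finset.disjoint_left]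
    exact fun x hx hxu => (hu hxu).2 hx
  have hge : ∀ x ∈ T ∪ u, δ ≤ lpNorm 2 x := by
    intro x hx
    rcases Finset.mem_union.1 hx with hx | hx
    · exact (hT x hx).ge
    · exact (hu hx).1
  have hneg : ∀ x : Fin d → ℝ, lpNorm 2 (0 - x) = lpNorm 2 x := by
    intro x
    rw [zero_sub, lpNorm_neg one_le_two]
  refine ⟨insert (0, 1) ((T ∪ u).image fun x => (x, 2)), ⟨?_, ?_⟩, ⟨?_, ?_⟩, by simp, ?_⟩
  · rw [Finset.card_insert_of_notMem (by simp), Finset.card_image_of_injective _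
      (fun _ _ h => (Prod.ext_iff.1 h).1), Finset.card_union_of_disjoint hdisj, huc]
    omega
  · intro z hz
    simp only [Finset.mem_insert, Finset.mem_image] at hz
    rcases hz with rfl | ⟨x, _, rfl⟩
    · exact ⟨le_rfl, by omega⟩
    · exact ⟨by norm_num, hC⟩
  · obtain ⟨x, hx⟩ := hne
    refine ⟨(0, 1), by simp, (x, 2), by simp [hx], by norm_num, ?_⟩
    rw [hneg, hT x hx]
  · rintro r ⟨z, hz, w, hw, hzw, rfl⟩
    simp only [Finset.mem_insert, Finset.mem_image] at hz hw
    rcases hz with rfl | ⟨x, hx, rfl⟩ <;> rcases hw with rfl | ⟨x', hx', rfl⟩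
    · exact absurd rfl hzw
    · rw [hneg]
      exact hge _ hx'
    · simpa using hge _ hx
    · exact absurd rfl hzw
  · intro x hx
    simp [hx]

/-- Volume bound for a separated set in a ball. -/
lemma card_le_of_separated {E : Type*} [NormedAddCommGroup E] [NormedSpace ℝ E]
    [FiniteDimensional ℝ E] {δ ε : ℝ} (hδ : 0 ≤ δ) (hε : 0 < ε) (s : Finset E)
    (hs : ∀ x ∈ s, ‖x‖ ≤ δ) (h : ∀ x ∈ s, ∀ y ∈ s, x ≠ y → ε ≤ ‖x - y‖) :
    (s.card : ℝ) ≤ (1 + 2 * δ / ε) ^ Module.finrank ℝ E := by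
  borelize E
  let μ : MeasureTheory.Measure E := MeasureTheory.Measure.addHaar
  have hdisj : Set.PairwiseDisjoint (s : Set E) fun c => Metric.ball c (ε / 2) := by
    intro x hx y hy hxy
    apply Metric.ball_disjoint_ball
    rw [dist_eq_norm, add_halves]
    exact h x hx y hy hxy
  have hsub : ⋃ c ∈ s, Metric.ball c (ε / 2) ⊆ Metric.ball (0 : E) (δ + ε / 2) := by
    refine Set.iUnion₂_subset fun x hx => Metric.ball_subset_ball' ?_
    rw [dist_zero_right]
    linarith [hs x hx]
  have I : (s.card : ℝ≥0∞) * ENNReal.ofReal ((ε / 2) ^ Module.finrank ℝ E) *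
      μ (Metric.ball 0 1) ≤
      ENNReal.ofReal ((δ + ε / 2) ^ Module.finrank ℝ E) * μ (Metric.ball 0 1) :=
    calc (s.card : ℝ≥0∞) * ENNReal.ofReal ((ε / 2) ^ Module.finrank ℝ E) * μ (Metric.ball 0 1)
        = μ (⋃ c ∈ s, Metric.ball c (ε / 2)) := by
          rw [MeasureTheory.measure_biUnion_finset hdisj fun c _ => measurableSet_ball]
          simp only [μ.addHaar_ball_of_pos _ (half_pos hε)]
          simp only [Finset.sum_const, nsmul_eq_mul, mul_assoc]
      _ ≤ μ (Metric.ball 0 (δ + ε / 2)) := MeasureTheory.measure_mono hsub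
      _ = _ := by rw [μ.addHaar_ball_of_pos _ (by linarith)]
  have J := (ENNReal.mul_le_mul_iff_left
    (Metric.measure_ball_pos μ (0 : E) zero_lt_one).ne' MeasureTheory.measure_ball_lt_top.ne).1 I
  have K := ENNReal.toReal_le_of_le_ofReal (by positivity) J
  rw [ENNReal.toReal_mul, ENNReal.toReal_natCast, ENNReal.toReal_ofReal (by positivity)] at K
  rw [← le_div_iff₀ (by positivity), ← div_pow] at K
  refine K.trans_eq ?_
  congr 1
  field_simp
  ring

lemma exists_net_sphere {E : Type*} [NormedAddCommGroup E] [NormedSpace ℝ E]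
    [FiniteDimensional ℝ E] {δ ε : ℝ} (hδ : 0 ≤ δ) (hε : 0 < ε) :
    ∃ s : Finset E, (∀ x ∈ s, ‖x‖ = δ) ∧ (∀ y : E, ‖y‖ = δ → ∃ x ∈ s, ‖y - x‖ ≤ ε) ∧
      (s.card : ℝ) ≤ (1 + 2 * δ / ε) ^ Module.finrank ℝ E := by
  classical
  let Q : Finset E → Prop := fun s =>
    (∀ x ∈ s, ‖x‖ = δ) ∧ ∀ x ∈ s, ∀ y ∈ s, x ≠ y → ε ≤ ‖x - y‖
  have hQ : ∀ s, Q s → (s.card : ℝ) ≤ (1 + 2 * δ / ε) ^ Module.finrank ℝ E := fun s hs =>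
    card_le_of_separated hδ hε s (fun x hx => (hs.1 x hx).le) hs.2
  let P : ℕ → Prop := fun n => ∃ s, Q s ∧ s.card = n
  -- a separated set of the largest possible cardinality is a net
  have hP0 : P 0 := ⟨∅, ⟨by simp, by simp⟩, rfl⟩
  have hPb : ∀ n, P n → n ≤ ⌊(1 + 2 * δ / ε) ^ Module.finrank ℝ E⌋₊ := by
    rintro n ⟨s, hs, rfl⟩
    exact Nat.le_floor (hQ s hs)
  obtain ⟨s, hs, hsc⟩ := Nat.findGreatest_spec (P := P) (Nat.zero_le _) hP0
  refine ⟨s, hs.1, fun y hy => ?_, hQ s hs⟩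
  by_contra! hcon
  have hys : y ∉ s := fun h => by
    have := hcon y h
    simp at this
    linarith
  have hP1 : P (s.card + 1) := by
    refine ⟨insert y s, ⟨?_, ?_⟩, Finset.card_insert_of_notMem hys⟩
    · intro x hx
      rcases Finset.mem_insert.1 hx with rfl | hx
      · exact hy
      · exact hs.1 x hx
    · intro x hx z hz hxz
      rcases Finset.mem_insert.1 hx with rfl | hx' <;>
        rcases Finset.mem_insert.1 hz with rfl | hz'
      · exact absurd rfl hxz
      · exact (hcon z hz').le
      · rw [norm_sub_rev]
        exact (hcon x hx').le
      · exact hs.2 x hx' z hz' hxz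
  have hmax := Nat.le_findGreatest (hPb _ hP1) hP1
  rw [← hsc] at hmax
  exact absurd hmax (Nat.lt_succ_self _).not_ge

lemma lpNorm_two_smul {d : ℕ} (t : ℝ) (x : Fin d → ℝ) :
    lpNorm 2 (t • x) = |t| * lpNorm 2 x := by
  rw [lpNorm, WithLp.toLp_smul, norm_smul, Real.norm_eq_abs]
  rfl

/-- An affine function that is constant on a ball is constant, hence cannot take two labels. -/
lemma not_robustlyMemorizes_affine {d : ℕ} {σ : ℝ} {p : ℝ≥0∞} (hp : 2 ≤ p) (hσ : 0 < σ)
    {D : Finset ((Fin d → ℝ) × ℕ)} (h1 : (0, 1) ∈ D) {x : Fin d → ℝ} (h2 : (x, 2) ∈ D)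
    {f : (Fin d → ℝ) → ℝ} (w : Fin d → ℝ) (b : ℝ) (hf : ∀ x, f x = w ⬝ᵥ x + b) :
    ¬ RobustlyMemorizes σ p f D := by
  intro h
  have hball : ∀ y z : Fin d → ℝ, lpNorm 2 (y - z) ≤ σ → lpNorm p (y - z) ≤ σ :=
    fun y z hyz => (lpNorm_le_lpNorm_two hp _).trans hyz
  have hz : lpNorm 2 (0 : Fin d → ℝ) = 0 := by simp [lpNorm]
  have e0 := h _ h1 0 (hball _ _ (by simp [hz, hσ.le]))
  have e2 := h _ h2 x (hball _ _ (by simp [hz, hσ.le]))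
  have hx0 : 0 ≤ lpNorm 2 x := norm_nonneg (WithLp.toLp 2 x)
  have ht : 0 < σ / (lpNorm 2 x + 1) := by positivity
  have e1 := h _ h1 ((σ / (lpNorm 2 x + 1)) • x) (hball _ _ (by
    rw [sub_zero, lpNorm_two_smul, abs_of_pos ht, div_mul_eq_mul_div, div_le_iff₀ (by positivity)]
    nlinarith))
  simp only [hf, dotProduct_zero, dotProduct_smul, smul_eq_mul] at e0 e1 e2
  push_cast at e0 e1 e2
  have : w ⬝ᵥ x = 0 := by
    have : σ / (lpNorm 2 x + 1) * (w ⬝ᵥ x) = 0 := by linarith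
    exact (mul_eq_zero.1 this).resolve_left ht.ne'
  linarith

lemma ReLUNet.exists_affine_of_width_eq_zero {d : ℕ} (f : ReLUNet d) (hf : f.width = 0) :
    ∃ (w : Fin d → ℝ) (b : ℝ), ∀ x, f.eval x = w ⬝ᵥ x + b := by
  cases f with
  | output W b => exact ⟨W 0, b 0, fun x => rfl⟩
  | @hidden _ m W b next =>
    have hm : m = 0 := by
      simp only [ReLUNet.width] at hf
      omega
    subst hm
    refine ⟨0, next.eval 0, fun x => ?_⟩
    rw [ReLUNet.eval, zero_dotProduct, zero_add]
    congr 1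
    exact Subsingleton.elim _ _

/-- A network of width `k` is affine, or else its first layer is constant along some direction of
any space of dimension greater than `k`. -/
lemma ReLUNet.exists_direction {d k : ℕ} {E : Type*} [AddCommGroup E] [Module ℝ E]
    [FiniteDimensional ℝ E] (hE : k < Module.finrank ℝ E) (J : E →ₗ[ℝ] (Fin d → ℝ))
    (f : ReLUNet d) (hf : f.width = k) :
    (∃ (w : Fin d → ℝ) (b : ℝ), ∀ x, f.eval x = w ⬝ᵥ x + b) ∨
    ∃ u : E, u ≠ 0 ∧ ∀ (t : ℝ) (x : Fin d → ℝ), f.eval (x - J (t • u)) = f.eval x := by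
  cases f with
  | output W b => exact .inl ⟨W 0, b 0, fun x => rfl⟩
  | @hidden _ m W b next =>
    refine .inr ?_
    have hm : m < Module.finrank ℝ E := by
      simp only [ReLUNet.width] at hf
      omega
    have hker := LinearMap.ker_ne_bot_of_finrank_lt (f := W.mulVecLin ∘ₗ J) (by simpa using hm)
    obtain ⟨u, hu, hu0⟩ := (Submodule.ne_bot_iff _).1 hker
    refine ⟨u, hu0, fun t x => ?_⟩
    have : W.mulVec (J (t • u)) = 0 := by
      have h : W.mulVec (J u) = 0 := hu
      rw [map_smul, Matrix.mulVec_smul, h, smul_zero]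
    simp only [ReLUNet.eval]
    rw [Matrix.mulVec_sub, this, sub_zero]

lemma exists_linearIsometry {n d : ℕ} (h : n ≤ d) :
    Nonempty (EuclideanSpace ℝ (Fin n) →ₗᵢ[ℝ] EuclideanSpace ℝ (Fin d)) := by
  let b := EuclideanSpace.basisFun (Fin n) ℝ
  let c := EuclideanSpace.basisFun (Fin d) ℝ
  let f := b.toBasis.constr ℝ (c ∘ Fin.castLE h)
  refine ⟨f.isometryOfOrthonormal (v := b.toBasis) (by simp) ?_⟩
  have : ⇑f ∘ ⇑b.toBasis = c ∘ Fin.castLE h := by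
    funext i
    simp [f]
  rw [this]
  exact c.orthonormal.comp _ (Fin.castLE_injective h)

section

variable {N d C k : ℕ} {δ σ : ℝ} {p : ℝ≥0∞}

/-- Two points at distance `δ` must have disjoint balls, and an affine network never suffices. -/
lemma WidthSuffices.two_lt_and_pos (h : WidthSuffices N d C k δ σ p) (hp : 2 ≤ p) (hN : 2 ≤ N)
    (hd : 0 < d) (hC : 2 ≤ C) (hδ : 0 < δ) (hσ : 0 < σ) : 2 * σ < δ ∧ 0 < k := by
  classical
  set x : Fin d → ℝ := Pi.single ⟨0, hd⟩ δ
  have hx : lpNorm 2 x = δ := by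
    have := PiLp.norm_single 2 (fun _ : Fin d => ℝ) ⟨0, hd⟩ δ
    rw [Real.norm_of_nonneg hδ.le] at this
    exact this
  obtain ⟨D, hD, hsep, h1, h2⟩ := exists_dataset (N := N) hd hC {x} (by simpa using hx)
    (by simp) (by simpa using hN)
  obtain ⟨f, hf, hfe⟩ := h D hD hsep
  have h2 := h2 x (by simp)
  constructor
  · by_contra! hcon
    have hhalf : lpNorm p ((1 / 2 : ℝ) • x) ≤ σ := by
      refine (lpNorm_le_lpNorm_two hp _).trans ?_
      rw [lpNorm_two_smul, hx, abs_of_pos (by norm_num)]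
      linarith
    have e1 := hfe _ h1 ((1 / 2 : ℝ) • x) (by simpa using hhalf)
    have e2 := hfe _ h2 ((1 / 2 : ℝ) • x) (by
      have : (1 / 2 : ℝ) • x - x = -((1 / 2 : ℝ) • x) := by module
      rw [this, lpNorm_neg (one_le_two.trans hp)]
      exact hhalf)
    rw [e1] at e2
    norm_num at e2
  · rcases Nat.eq_zero_or_pos k with rfl | hk
    · obtain ⟨w, b, hwb⟩ := f.exists_affine_of_width_eq_zero hf
      exact absurd hfe (not_robustlyMemorizes_affine hp hσ h1 h2 w b hwb)
    · exact hk

/-- A `2σ`-net of a `k`-dimensional sphere of radius `δ` cannot be separated from its centre: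
some direction that the first layer does not see passes within `2σ` of a point of the net. -/
lemma WidthSuffices.card_le (h : WidthSuffices N d C k δ σ p) (hp : 2 ≤ p) (hkd : k < d)
    (hC : 2 ≤ C) (hδ : 0 < δ) (hσ : 0 < σ) : (N : ℝ) ≤ (1 + δ / σ) ^ (k + 1) := by
  classical
  obtain ⟨J⟩ := exists_linearIsometry (n := k + 1) (d := d) hkd
  obtain ⟨s, hs, hcov, hcard⟩ := exists_net_sphere (E := EuclideanSpace ℝ (Fin (k + 1)))
    hδ.le (by positivity : 0 < 2 * σ)
  rw [finrank_euclideanSpace_fin, mul_div_mul_left _ _ two_ne_zero] at hcard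
  by_contra! hcon
  have hsN : s.card + 1 ≤ N := by
    have : (s.card : ℝ) < N := hcard.trans_lt hcon
    exact_mod_cast this
  have hJ : ∀ y, lpNorm 2 (J y).ofLp = ‖y‖ := fun y => J.norm_map y
  let T : Finset (Fin d → ℝ) := s.image fun y => (J y).ofLp
  have hT : ∀ x ∈ T, lpNorm 2 x = δ := by
    intro x hx
    obtain ⟨y, hy, rfl⟩ := Finset.mem_image.1 hx
    rw [hJ, hs y hy]
  obtain ⟨y₀, hy₀⟩ : ∃ y₀ : EuclideanSpace ℝ (Fin (k + 1)), ‖y₀‖ = δ :=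
    ⟨EuclideanSpace.single 0 δ, by simp [hδ.le]⟩
  obtain ⟨x₀, hx₀, -⟩ := hcov y₀ hy₀
  obtain ⟨D, hD, hsep, h1, h2⟩ := exists_dataset (N := N) (by omega) hC T hT
    ⟨_, Finset.mem_image_of_mem _ hx₀⟩
    ((Nat.add_le_add_right Finset.card_image_le 1).trans hsN)
  obtain ⟨f, hf, hfe⟩ := h D hD hsep
  let J' : EuclideanSpace ℝ (Fin (k + 1)) →ₗ[ℝ] (Fin d → ℝ) :=
    (WithLp.linearEquiv 2 ℝ (Fin d → ℝ)).toLinearMap ∘ₗ J.toLinearMap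
  have hJ' : ∀ y, lpNorm 2 (J' y) = ‖y‖ := hJ
  have hmem : ∀ y ∈ s, (J' y, 2) ∈ D := fun y hy => h2 _ (Finset.mem_image_of_mem _ hy)
  rcases f.exists_direction (k := k) (by simp) J' hf with ⟨w, b, hwb⟩ | ⟨u, hu, hfu⟩
  · exact not_robustlyMemorizes_affine hp hσ h1 (hmem _ hx₀) w b hwb hfe
  · have hu' : 0 < ‖u‖ := norm_pos_iff.2 hu
    set y := (δ / ‖u‖) • u with hy
    have hyn : ‖y‖ = δ := by
      rw [hy, norm_smul, Real.norm_of_nonneg (by positivity), div_mul_cancel₀ _ hu'.ne']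
    obtain ⟨v, hv, hyv⟩ := hcov y hyn
    -- the midpoint of `v` and `y`, and its translate by `-y`, lie in the two balls
    have hn : ‖(1 / 2 : ℝ) • (y - v)‖ ≤ σ := by
      rw [norm_smul, Real.norm_of_nonneg (by norm_num)]
      linarith
    have e2 := hfe _ (hmem v hv) (J' ((1 / 2 : ℝ) • (y + v))) (by
      refine (lpNorm_le_lpNorm_two hp _).trans ?_
      rw [← map_sub, hJ']
      have : (1 / 2 : ℝ) • (y + v) - v = (1 / 2 : ℝ) • (y - v) := by module
      rwa [this])
    have e1 := hfe _ h1 (J' ((1 / 2 : ℝ) • (y + v)) - J' y) (by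
      refine (lpNorm_le_lpNorm_two hp _).trans ?_
      rw [sub_zero, ← map_sub, hJ']
      have : (1 / 2 : ℝ) • (y + v) - y = -((1 / 2 : ℝ) • (y - v)) := by module
      rwa [this, norm_neg])
    rw [hfu, e2] at e1
    norm_num at e1

theorem WidthSuffices.lt_width (h : WidthSuffices N d C k δ σ p) (hp : 2 ≤ p) (hN : 2 ≤ N)
    (hkd : k < d) (hC : 2 ≤ C) (hδ : 0 < δ) (hσ : 0 < σ) :
    1 < δ / σ ∧ 1 / 5 * Real.log N / Real.log (δ / σ) < (k : ℝ) := by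
  obtain ⟨h2, hk⟩ := h.two_lt_and_pos hp hN (by omega) hC hδ hσ
  have hR : 2 < δ / σ := (lt_div_iff₀ hσ).2 h2
  have hcard := h.card_le hp hkd hC hδ hσ
  set R := δ / σ
  have hk' : (1 : ℝ) ≤ k := by exact_mod_cast hk
  have hlR : 0 < Real.log R := Real.log_pos (by linarith)
  refine ⟨by linarith, ?_⟩
  rw [div_lt_iff₀ hlR]
  have hN0 : (0 : ℝ) < N := by exact_mod_cast (by omega : 0 < N)
  have h3 := Real.log_le_log hN0 hcard
  rw [Real.log_pow] at h3
  push_cast at h3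
  have h4 : Real.log (1 + R) ≤ 2 * Real.log R := by
    have : Real.log (1 + R) ≤ Real.log (R ^ 2) := Real.log_le_log (by linarith) (by nlinarith)
    rwa [Real.log_pow, Nat.cast_ofNat] at this
  have h5 : Real.log N ≤ (k + 1) * (2 * Real.log R) :=
    h3.trans (mul_le_mul_of_nonneg_left h4 (by linarith))
  nlinarith

end

end RobustMemo

/-! ### Both bounds -/

theorem mainTheorem4 :
    -- the two universal constants, with the sufficient and the necessary width
    (∃ C₁ C₂ : ℝ, 0 < C₁ ∧ 0 < C₂ ∧
      ∀ (p : ℝ≥0∞) (N d C k : ℕ) (δ σ : ℝ), 2 ≤ p → 2 ≤ N → 2 ≤ d → 2 ≤ C → k < d →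
        0 < δ → 0 < σ →
        (7 ≤ k → (d : ℝ) < δ / σ →
          C₁ * Real.log N / (Real.log (δ / σ) - Real.log d) < (k : ℝ) →
          RobustMemo.WidthSuffices N d C k δ σ p) ∧
        (RobustMemo.WidthSuffices N d C k δ σ p →
          1 < δ / σ ∧ C₂ * Real.log N / Real.log (δ / σ) < (k : ℝ))) ∧
    -- logarithmic width is sufficient when the radius does not depend on `N`
    (∀ η : ℝ, 1 < η → ∃ b : ℝ, 0 < b ∧
      ∀ (p : ℝ≥0∞) (N d C k : ℕ) (δ σ : ℝ), 2 ≤ p → 2 ≤ N → 2 ≤ d → 2 ≤ C → k < d →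
        0 < δ → 0 < σ → η * d ≤ δ / σ → 7 ≤ k → b * Real.log N < (k : ℝ) →
        RobustMemo.WidthSuffices N d C k δ σ p) ∧
    -- logarithmic width is necessary when the radius does not depend on `N`
    (∀ ρ : ℝ, 0 < ρ → ∃ a : ℝ, 0 < a ∧
      ∀ (p : ℝ≥0∞) (N d C k : ℕ) (δ σ : ℝ), 2 ≤ p → 2 ≤ N → 2 ≤ d → 2 ≤ C → k < d →
        0 < δ → 0 < σ → ρ ≤ σ / δ → RobustMemo.WidthSuffices N d C k δ σ p →
        a * Real.log N < (k : ℝ)) := by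
  refine ⟨⟨3000, 1 / 5, by norm_num, by norm_num, ?_⟩, ?_, ?_⟩
  · intro p N d C k δ σ hp hN _ hC hkd hδ hσ
    exact ⟨fun hk hd h =>
      RobustMemo.widthSuffices_of_lt (one_le_two.trans hp) hN hkd hδ hσ hk hd h,
      fun h => h.lt_width hp hN hkd hC hδ hσ⟩
  · intro η hη
    have hlη : 0 < Real.log η := Real.log_pos hη
    refine ⟨3000 / Real.log η, by positivity, ?_⟩
    intro p N d C k δ σ hp hN hd _ hkd hδ hσ hle hk h
    have hd0 : (0 : ℝ) < d := by exact_mod_cast (by omega : 0 < d)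
    have hlog : Real.log η ≤ Real.log (δ / σ) - Real.log d := by
      rw [le_sub_iff_add_le, ← Real.log_mul (by positivity) hd0.ne']
      exact Real.log_le_log (by positivity) hle
    have hlN : 0 ≤ Real.log N := Real.log_natCast_nonneg N
    refine RobustMemo.widthSuffices_of_lt (one_le_two.trans hp) hN hkd hδ hσ hk (by nlinarith)
      (lt_of_le_of_lt ?_ h)
    rw [div_mul_eq_mul_div]
    gcongr
  · intro ρ hρ
    -- for `ρ ≥ 1` the logarithm is not positive; the maximum keeps `a` positive
    refine ⟨1 / 5 / max 1 (Real.log (1 / ρ)), by positivity, ?_⟩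
    intro p N d C k δ σ hp hN _ hC hkd hδ hσ hle h
    obtain ⟨h1, h2⟩ := h.lt_width hp hN hkd hC hδ hσ
    refine lt_of_le_of_lt ?_ h2
    have hlog : Real.log (δ / σ) ≤ max 1 (Real.log (1 / ρ)) := by
      refine le_max_of_le_right (Real.log_le_log (by positivity) ?_)
      rw [← one_div_div]
      exact one_div_le_one_div_of_le hρ hle
    have hlN : 0 ≤ Real.log N := Real.log_natCast_nonneg N
    have hl := Real.log_pos h1
    rw [div_mul_eq_mul_div]
    gcongr
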